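/- A convex domain is a compact convex set $\Omega\subset\mathbb R^2$ with nonempty interior. Let $\mathcal U_\Omega$ be the class of continuous concave functions $u$ on $\Omega$ such that $u|_{\partial\Omega}=0$ and the gradient $\nabla u$ is uniformly bounded over all points of $\operatorname{int}\Omega$ where it is defined. For $h\in\mathbb R^2$ put $u_h=(\nabla u,h)$ (defined almost everywhere on $\Omega$), let $u_x,u_y$ be the partial derivatives, and let $\|f\|_\infty=\operatorname{ess\,sup}_{\Omega}|f|$. Set $$K_\infty(\Omega)=\sup_{u\in\mathcal U_\Omega,\,u\ne0}\frac{\|u_x\|_\infty}{\|u_y\|_\infty},\qquad k_\infty(\Omega)=\inf_{u\in\mathcal U_\Omega,\,u\ne0}\frac{\|u_x\|_\infty}{\|u_y\|_\infty},$$ with values in $[0,+\infty]$; the quotient $K_\infty(\Omega)/k_\infty(\Omega)$ is read as $+\infty$ if $K_\infty(\Omega)=+\infty$ or $k_\infty(\Omega)=0$. Then $$\inf_\Omega\frac{K_\infty(\Omega)}{k_\infty(\Omega)}=1,$$ where the infimum is over all convex domains, and it is attained at every (nondegenerate) parallelogram $\Omega$ whose sides are non-vertical and have slopes of equal absolute value.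 More generally, for all nonzero vectors $h_1,h_2\in\mathbb R^2$, $$\inf_\Omega\ \frac{\sup_{u\in\mathcal U_\Omega,\,u\ne0}\ \|u_{h_1}\|_\infty/\|u_{h_2}\|_\infty}{\inf_{u\in\mathcal U_\Omega,\,u\ne0}\ \|u_{h_1}\|_\infty/\|u_{h_2}\|_\infty}=1$$ (with the same convention for the quotient), and the infimum is attained at every (nondegenerate) parallelogram $\Omega$ with sides parallel to $h_1+h_2$ and $h_1-h_2$ (such parallelograms exist precisely when $h_1,h_2$ are not collinear). -/

import Mathlib

open MeasureTheory Set
open scoped ENNReal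

/-- The Euclidean plane. -/
abbrev Plane : Type := EuclideanSpace ℝ (Fin 2)

/-- The unit vector of the `x`-axis. -/
noncomputable def dirX : Plane := EuclideanSpace.single 0 1

/-- The unit vector of the `y`-axis. -/
noncomputable def dirY : Plane := EuclideanSpace.single 1 1

/-- Convex compact domains of the plane: compact convex sets with interior points. -/
structure IsConvexDomain (Ω : Set Plane) : Prop where
  isCompact : IsCompact Ω
  convex : Convex ℝ Ω
  interior_nonempty : (interior Ω).Nonempty

/-- The class `𝒰_Ω`: continuous concave functions on `Ω` that vanish on the boundary of `Ω` and
whose gradient is uniformly bounded over the interior points of `Ω` where it exists. The values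
of `u` outside `Ω` play no role. -/
structure IsAdmissible (Ω : Set Plane) (u : Plane → ℝ) : Prop where
  continuousOn : ContinuousOn u Ω
  concaveOn : ConcaveOn ℝ Ω u
  eq_zero_of_mem_frontier : ∀ z ∈ frontier Ω, u z = 0
  gradient_bounded : ∃ C : ℝ, ∀ z ∈ interior Ω, DifferentiableAt ℝ u z → ‖fderiv ℝ u z‖ ≤ C

/-- The nonzero elements of `𝒰_Ω`. -/
def admissibleNonzero (Ω : Set Plane) : Set (Plane → ℝ) :=
  {u | IsAdmissible Ω u ∧ ∃ z ∈ Ω, u z ≠ 0}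

/-- The norm `‖u_h‖_p` in `L_p(Ω)` of the derivative `u_h = (∇u, h)` of `u` along `h`. (A function
in `𝒰_Ω` is differentiable at almost every point of `Ω`.) -/
noncomputable def dirNorm (p : ℝ≥0∞) (Ω : Set Plane) (u : Plane → ℝ) (h : Plane) : ℝ≥0∞ :=
  eLpNorm (fun z => fderiv ℝ u z h) p (volume.restrict Ω)

/-- The supremum of `‖u_{h₁}‖_p / ‖u_{h₂}‖_p` over the nonzero `u ∈ 𝒰_Ω`, in `[0, ∞]`. -/
noncomputable def supRatio (p : ℝ≥0∞) (Ω : Set Plane) (h₁ h₂ : Plane) : ℝ≥0∞ :=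
  ⨆ u ∈ admissibleNonzero Ω, dirNorm p Ω u h₁ / dirNorm p Ω u h₂

/-- The infimum of `‖u_{h₁}‖_p / ‖u_{h₂}‖_p` over the nonzero `u ∈ 𝒰_Ω`. -/
noncomputable def infRatio (p : ℝ≥0∞) (Ω : Set Plane) (h₁ h₂ : Plane) : ℝ≥0∞ :=
  ⨅ u ∈ admissibleNonzero Ω, dirNorm p Ω u h₁ / dirNorm p Ω u h₂

/-- `K_p(Ω)`, the supremum of `‖u_x‖_p / ‖u_y‖_p`. -/
noncomputable def bigK (p : ℝ≥0∞) (Ω : Set Plane) : ℝ≥0∞ := supRatio p Ω dirX dirY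

/-- `k_p(Ω)`, the infimum of `‖u_x‖_p / ‖u_y‖_p`. -/
noncomputable def smallK (p : ℝ≥0∞) (Ω : Set Plane) : ℝ≥0∞ := infRatio p Ω dirX dirY

/-- The parallelogram with vertices `c`, `c + v`, `c + w`, `c + v + w`; it is nondegenerate when
`v` and `w` are linearly independent. -/
def parallelogram (c v w : Plane) : Set Plane :=
  {z | ∃ s ∈ Icc (0 : ℝ) 1, ∃ t ∈ Icc (0 : ℝ) 1, z = c + s • v + t • w}

/-! On any convex domain one nonzero admissible `u` with finite, nonzero norms already gives sup/inf
≥ r/r = 1, where r is its ratio; the distance to the complement is such a function. It remains to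
find domains on which the ratio is the same for all `u`.

Let the sides of a parallelogram be along `v` and `w`, and put h₁ = σv + τw, h₂ = σv - τw. From an
interior point z follow h₁ until it meets a side at y = z + T h₁, and let q be the midpoint of z and
y. Reflection in that side turns h₁ into ±h₂ in affine coordinates, so q is also reached from a
point x of the same side by a step ±(T/2)h₂. As u(x) = 0, this gives u(q) ≤ (T/2)‖u_{h₂}‖_∞, while
concavity and u(y) = 0 give u(q) ≥ u(z)/2. Hence u(z) ≤ T‖u_{h₂}‖_∞, and the tangent inequality 0 =
u(y) ≤ u(z) + T u_{h₁}(z) yields -u_{h₁}(z) ≤ ‖u_{h₂}‖_∞ (`neg_fderiv_le_of_exit`). The symmetries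
of the configuration give the other signs and the reverse inequality, so the two norms agree
(`dirNorm_parallelogram_eq`). For collinear h₁, h₂ the ratio is constant on every domain. -/

open Metric Filter Topology

/-! ### Concave functions and their points of differentiability -/

/-- The tangent inequality for a concave function. -/
theorem ConcaveOn.le_add_fderiv {E : Type*} [NormedAddCommGroup E] [NormedSpace ℝ E]
    {s : Set E} {u : E → ℝ} (hu : ConcaveOn ℝ s u) {z d : E} (hz : z ∈ s) (hd : z + d ∈ s)
    (hdiff : DifferentiableAt ℝ u z) : u (z + d) ≤ u z + fderiv ℝ u z d := by
  have hline : HasDerivAt (fun t : ℝ => z + t • d) d 0 := by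
    simpa using ((hasDerivAt_id (0 : ℝ)).smul_const d).const_add z
  have hg : HasDerivAt (fun t : ℝ => u (z + t • d)) (fderiv ℝ u z d) 0 := by
    have h1 : HasFDerivAt u (fderiv ℝ u z) (z + (0 : ℝ) • d) := by
      simpa using hdiff.hasFDerivAt
    exact h1.comp_hasDerivAt (0 : ℝ) hline
  have hc : ConcaveOn ℝ (AffineMap.lineMap (k := ℝ) z (z + d) ⁻¹' s)
      (u ∘ AffineMap.lineMap (k := ℝ) z (z + d)) := hu.comp_affineMap _
  have heq : (u ∘ AffineMap.lineMap (k := ℝ) z (z + d)) = fun t : ℝ => u (z + t • d) := by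
    funext t
    simp [AffineMap.lineMap_apply, add_comm]
  rw [heq] at hc
  have := hc.slope_le_of_hasDerivAt (x := 0) (y := 1) (by simpa using hz) (by simpa using hd)
    zero_lt_one hg
  simp only [slope_def_field, one_smul, zero_smul, add_zero, sub_zero, div_one] at this
  linarith

/-- In each nonempty open part of the domain of a concave function, a property that holds almost
everywhere holds at some point of differentiability. -/
theorem ConcaveOn.exists_differentiableAt {Ω : Set Plane} {u : Plane → ℝ}
    (hu : ConcaveOn ℝ Ω u) {P : Plane → Prop} (hP : ∀ᵐ z ∂volume.restrict Ω, P z)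
    {x : Plane} (hx : x ∈ interior Ω) {W : Set Plane} (hW : W ∈ 𝓝 x) :
    ∃ z ∈ W, z ∈ interior Ω ∧ DifferentiableAt ℝ u z ∧ P z := by
  obtain ⟨K, t, ht, hK⟩ := hu.locallyLipschitzOn_interior hx
  rw [isOpen_interior.nhdsWithin_eq hx] at ht
  set V := interior (t ∩ W ∩ interior Ω) with hV
  have hxV : x ∈ V := mem_interior_iff_mem_nhds.2
    (inter_mem (inter_mem ht hW) (isOpen_interior.mem_nhds hx))
  have hVsub : V ⊆ t ∩ W ∩ interior Ω := interior_subset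
  have hVo : IsOpen V := isOpen_interior
  have hpos : volume V ≠ 0 := (hVo.measure_pos volume ⟨x, hxV⟩).ne'
  -- Rademacher's theorem, since `u` is Lipschitz on `V`.
  have h1 : ∀ᵐ z ∂(volume : Measure Plane), z ∈ V → DifferentiableWithinAt ℝ u V z :=
    (hK.mono fun z hz => (hVsub hz).1.1).ae_differentiableWithinAt_of_mem
  have h2 : ∀ᵐ z ∂(volume.restrict V), P z :=
    ae_restrict_of_ae_restrict_of_subset
      (fun z hz => interior_subset (hVsub hz).2) hP
  rw [ae_restrict_iff' hVo.measurableSet] at h2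
  obtain ⟨z, hzV, hz1, hz2⟩ : ∃ z ∈ V, (z ∈ V → DifferentiableWithinAt ℝ u V z) ∧
      (z ∈ V → P z) := by
    by_contra hcon
    push Not at hcon
    refine hpos (measure_mono_null (fun z hz => ?_) (h1.and h2))
    intro hzz
    have := hcon z hz hzz.1
    exact this.2 (hzz.2 this.1)
  exact ⟨z, (hVsub hzV).1.2, (hVsub hzV).2, (hz1 hzV).differentiableAt (hVo.mem_nhds hzV),
    hz2 hzV⟩

/-! ### Convex domains and the distance to the complement -/

namespace IsConvexDomain

variable {Ω : Set Plane}

theorem subset_closure_interior (hΩ : IsConvexDomain Ω) : Ω ⊆ closure (interior Ω) := by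
  rw [hΩ.convex.closure_interior_eq_closure_of_nonempty_interior hΩ.interior_nonempty]
  exact subset_closure

/-- Every ray starting in a convex domain meets the boundary. -/
theorem exists_add_smul_mem_frontier (hΩ : IsConvexDomain Ω) {z h : Plane} (hz : z ∈ Ω)
    (hh : h ≠ 0) : ∃ r : ℝ, 0 ≤ r ∧ z + r • h ∈ frontier Ω := by
  have hconn : IsPreconnected ((fun r : ℝ => z + r • h) '' Ici 0) :=
    isPreconnected_Ici.image _ (by fun_prop)
  obtain ⟨R, hR⟩ := hΩ.isCompact.isBounded.subset_closedBall z
  have hpos : 0 < ‖h‖ := norm_pos_iff.2 hh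
  have hR0 : 0 ≤ R := by simpa using dist_nonneg.trans (hR hz)
  by_contra! hcon
  have hcover : (fun r : ℝ => z + r • h) '' Ici 0 ⊆ interior Ω ∪ Ωᶜ := by
    rintro _ ⟨r, hr, rfl⟩
    by_cases hmem : z + r • h ∈ Ω
    · left
      by_contra hi
      exact hcon r hr ⟨subset_closure hmem, hi⟩
    · exact Or.inr hmem
  have hzi : z ∈ interior Ω := by
    by_contra hi
    exact hcon 0 le_rfl (by simpa using ⟨subset_closure hz, hi⟩)
  -- The second point of the ray is at distance `R + 1` from `z`, hence outside `Ω`; connectedness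
  -- then contradicts the disjoint open cover.
  obtain ⟨y, -, hy₁, hy₂⟩ := hconn (interior Ω) Ωᶜ isOpen_interior
    hΩ.isCompact.isClosed.isOpen_compl hcover ⟨z, ⟨0, by simp, by simp⟩, hzi⟩
    ⟨z + ((R + 1) / ‖h‖) • h, ⟨_, by simp only [mem_Ici]; positivity, rfl⟩, fun hmem => by
      have := hR hmem
      rw [mem_closedBall, dist_eq_norm, add_sub_cancel_left, norm_smul, Real.norm_eq_abs,
        abs_of_nonneg (by positivity), div_mul_cancel₀ _ hpos.ne'] at this
      linarith⟩
  exact hy₂ (interior_subset hy₁)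

theorem infDist_compl_pos (hΩ : IsConvexDomain Ω) {z : Plane} (hz : z ∈ interior Ω) :
    0 < infDist z Ωᶜ := by
  have hne : (Ωᶜ).Nonempty := by
    by_contra hcon
    rw [not_nonempty_iff_eq_empty, compl_empty_iff] at hcon
    exact NoncompactSpace.noncompact_univ (X := Plane) (hcon ▸ hΩ.isCompact)
  refine (infDist_pos_iff_notMem_closure hne).1 ?_
  rwa [closure_compl, notMem_compl_iff]

end IsConvexDomain

/-- The distance to the complement of a convex set is concave on the set. -/
theorem Convex.concaveOn_infDist_compl {E : Type*} [NormedAddCommGroup E] [NormedSpace ℝ E]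
    {s : Set E} (hs : Convex ℝ s) : ConcaveOn ℝ s fun z => infDist z sᶜ := by
  refine ⟨hs, fun x hx y hy a b ha hb hab => ?_⟩
  rcases (sᶜ).eq_empty_or_nonempty with he | hne
  · simp [he]
  refine (le_infDist hne).2 fun {q} hq => ?_
  by_contra! hlt
  simp only [smul_eq_mul] at hlt
  set r₁ := infDist x sᶜ
  set r₂ := infDist y sᶜ
  set R := a * r₁ + b * r₂
  have hr₁ : 0 ≤ r₁ := infDist_nonneg
  have hr₂ : 0 ≤ r₂ := infDist_nonneg
  have hR : 0 < R := dist_nonneg.trans_lt hlt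
  set e := q - (a • x + b • y) with he
  have hnorm : ‖e‖ < R := by rwa [dist_comm, dist_eq_norm] at hlt
  -- The displacement `e` is split in proportion to the two distances: each endpoint moves by less
  -- than its own distance to `sᶜ`, or not at all.
  have key : ∀ p ∈ s, p + (infDist p sᶜ / R) • e ∈ s := by
    intro p hp
    by_contra hmem
    have h1 : infDist p sᶜ ≤ ‖(infDist p sᶜ / R) • e‖ := by
      have := infDist_le_dist_of_mem (x := p) (mem_compl hmem)
      rwa [dist_comm, dist_eq_norm, add_sub_cancel_left] at this
    have h0 : 0 ≤ infDist p sᶜ := infDist_nonneg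
    rcases h0.eq_or_lt with h0 | h0
    · rw [← h0] at hmem
      simp [hp] at hmem
    · rw [norm_smul, Real.norm_eq_abs, abs_of_nonneg (by positivity), div_mul_eq_mul_div,
        le_div_iff₀ hR] at h1
      exact absurd hnorm (not_lt.2 (le_of_mul_le_mul_left h1 h0))
  refine hq ?_
  have hq' : q = a • (x + (r₁ / R) • e) + b • (y + (r₂ / R) • e) := by
    have h1 : a * (r₁ / R) + b * (r₂ / R) = 1 := by
      rw [← mul_div_assoc, ← mul_div_assoc, ← add_div, div_self hR.ne']
    have h2 : q = (a • x + b • y) + (a * (r₁ / R) + b * (r₂ / R)) • e := by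
      rw [h1, one_smul, he]; abel
    rw [h2]
    module
  rw [hq']
  exact hs (key x hx) (key y hy) ha hb hab

/-- Without a nonzero admissible function the supremum would be 0 and the infimum ∞. -/
theorem IsConvexDomain.admissibleNonzero_nonempty {Ω : Set Plane} (hΩ : IsConvexDomain Ω) :
    (admissibleNonzero Ω).Nonempty := by
  obtain ⟨z, hz⟩ := hΩ.interior_nonempty
  refine ⟨fun z => infDist z Ωᶜ, ⟨(continuous_infDist_pt _).continuousOn,
    hΩ.convex.concaveOn_infDist_compl, fun y hy => ?_, 1, fun y _ _ => ?_⟩, z,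
    interior_subset hz, (hΩ.infDist_compl_pos hz).ne'⟩
  · rw [← frontier_compl] at hy
    exact infDist_zero_of_mem_closure (frontier_subset_closure hy)
  · simpa using norm_fderiv_le_of_lipschitz ℝ (lipschitz_infDist_pt (Ωᶜ)) (x₀ := y)

/-! ### Directional norms of admissible functions -/

namespace IsAdmissible

variable {Ω : Set Plane} {u : Plane → ℝ}

/-- A bound for the derivative along `h` almost everywhere bounds the increments along `h`. -/
theorem le_add_mul_abs (hΩ : IsConvexDomain Ω) (hu : IsAdmissible Ω u) {h : Plane} {N : ℝ}
    (hN : ∀ᵐ z ∂volume.restrict Ω, |fderiv ℝ u z h| ≤ N) {b : Plane} {r : ℝ}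
    (hb : b ∈ Ω) (ha : b + r • h ∈ interior Ω) : u (b + r • h) ≤ u b + N * |r| := by
  set D := {z | z ∈ interior Ω ∧ DifferentiableAt ℝ u z ∧ |fderiv ℝ u z h| ≤ N}
  -- The point `b` may lie on the boundary, where no tangent inequality is available; it is
  -- approached by points that satisfy the bound, and the estimate passes to the limit.
  have hbD : b ∈ closure D := by
    have h1 : interior Ω ⊆ closure D := fun x hx => mem_closure_iff_nhds.2 fun W hW => by
      obtain ⟨z, hzW, hz⟩ := hu.concaveOn.exists_differentiableAt hN hx hW
      exact ⟨z, hzW, hz⟩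
    exact closure_minimal h1 isClosed_closure (hΩ.subset_closure_interior hb)
  have hbot : (𝓝[D] b).NeBot := mem_closure_iff_nhdsWithin_neBot.1 hbD
  have hshift : Tendsto (fun z => z + r • h) (𝓝[D] b) (𝓝 (b + r • h)) :=
    (Continuous.tendsto (by fun_prop) b).mono_left nhdsWithin_le_nhds
  have hlim1 : Tendsto (fun z => u (z + r • h)) (𝓝[D] b) (𝓝 (u (b + r • h))) :=
    (hu.continuousOn.continuousAt (mem_interior_iff_mem_nhds.1 ha)).tendsto.comp hshift
  have hlim2 : Tendsto (fun z => u z + N * |r|) (𝓝[D] b) (𝓝 (u b + N * |r|)) :=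
    ((hu.continuousOn b hb).mono fun z hz => interior_subset hz.1).tendsto.add_const _
  refine le_of_tendsto_of_tendsto hlim1 hlim2 ?_
  filter_upwards [self_mem_nhdsWithin, hshift (isOpen_interior.mem_nhds ha)] with z hz hz'
  have h1 := hu.concaveOn.le_add_fderiv (interior_subset hz.1) (interior_subset hz') hz.2.1
  rw [map_smul, smul_eq_mul] at h1
  have h2 : r * fderiv ℝ u z h ≤ N * |r| := by
    calc r * fderiv ℝ u z h ≤ |r * fderiv ℝ u z h| := le_abs_self _
      _ = |fderiv ℝ u z h| * |r| := by rw [abs_mul, mul_comm]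
      _ ≤ N * |r| := by gcongr; exact hz.2.2
  linarith

/-- Bounds at the interior points of differentiability are bounds for the `L_∞` norm. -/
theorem dirNorm_top_le (hΩ : IsConvexDomain Ω) {h : Plane} {C : ℝ}
    (hC0 : 0 ≤ C)
    (hC : ∀ z ∈ interior Ω, DifferentiableAt ℝ u z → |fderiv ℝ u z h| ≤ C) :
    dirNorm ∞ Ω u h ≤ ENNReal.ofReal C := by
  rw [dirNorm, eLpNorm_exponent_top]
  refine eLpNormEssSup_le_of_ae_bound ?_
  have hmeas : MeasurableSet Ω := hΩ.isCompact.measurableSet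
  have hfr : ∀ᵐ z ∂(volume : Measure Plane), z ∉ frontier Ω :=
    measure_eq_zero_iff_ae_notMem.1 (hΩ.convex.addHaar_frontier volume)
  rw [ae_restrict_iff' hmeas]
  filter_upwards [hfr] with z hz hzΩ
  have hzi : z ∈ interior Ω := by
    by_contra hcon
    exact hz ⟨subset_closure hzΩ, hcon⟩
  by_cases hd : DifferentiableAt ℝ u z
  · simpa using hC z hzi hd
  -- Here `fderiv` takes its default value 0, which is why `hC0` is needed.
  · simpa [fderiv_zero_of_not_differentiableAt hd] using hC0

theorem dirNorm_top_lt_top (hΩ : IsConvexDomain Ω) (hu : IsAdmissible Ω u) (h : Plane) :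
    dirNorm ∞ Ω u h < ∞ := by
  obtain ⟨C, hC⟩ := hu.gradient_bounded
  refine (dirNorm_top_le hΩ (C := |C| * ‖h‖) (by positivity) fun z hz hd => ?_).trans_lt
    ENNReal.ofReal_lt_top
  calc |fderiv ℝ u z h| ≤ ‖fderiv ℝ u z‖ * ‖h‖ := (fderiv ℝ u z).le_opNorm h
    _ ≤ |C| * ‖h‖ := by gcongr; exact (hC z hz hd).trans (le_abs_self C)

theorem ae_abs_fderiv_le (hΩ : IsConvexDomain Ω) (hu : IsAdmissible Ω u) (h : Plane) :
    ∀ᵐ z ∂volume.restrict Ω, |fderiv ℝ u z h| ≤ (dirNorm ∞ Ω u h).toReal := by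
  have hlt := hu.dirNorm_top_lt_top hΩ h
  have := ae_le_eLpNormEssSup (f := fun z => fderiv ℝ u z h) (μ := volume.restrict Ω)
  filter_upwards [this] with z hz
  rw [← eLpNorm_exponent_top] at hz
  have := ENNReal.toReal_mono hlt.ne hz
  simpa using this

/-- With zero derivative along `h`, `u` cannot grow from its boundary value 0 along a chord in that
direction; concavity between the ends of the chord prevents negative values. -/
theorem dirNorm_top_ne_zero (hΩ : IsConvexDomain Ω) (hu : u ∈ admissibleNonzero Ω) {h : Plane}
    (hh : h ≠ 0) : dirNorm ∞ Ω u h ≠ 0 := by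
  obtain ⟨hu, z, hz, huz⟩ := hu
  intro h0
  have hN := hu.ae_abs_fderiv_le hΩ h
  rw [h0, ENNReal.toReal_zero] at hN
  have hzi : z ∈ interior Ω := by
    by_contra hcon
    exact huz (hu.eq_zero_of_mem_frontier z ⟨subset_closure hz, hcon⟩)
  obtain ⟨r₁, hr₁, hb₁⟩ := hΩ.exists_add_smul_mem_frontier hz hh
  obtain ⟨r₂, hr₂, hb₂⟩ := hΩ.exists_add_smul_mem_frontier hz (neg_ne_zero.2 hh)
  have hΩ₁ := hΩ.isCompact.isClosed.frontier_subset hb₁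
  have hΩ₂ := hΩ.isCompact.isClosed.frontier_subset hb₂
  have hle : u z ≤ 0 := by
    have := hu.le_add_mul_abs hΩ hN (b := z + r₁ • h) (r := -r₁) hΩ₁ (by simpa using hzi)
    rw [hu.eq_zero_of_mem_frontier _ hb₁] at this
    simpa using this
  have hge : 0 ≤ u z := by
    have hr₁' : r₁ ≠ 0 := fun h => by
      rw [h, zero_smul, add_zero] at hb₁
      exact hb₁.2 hzi
    have hpos : 0 < r₁ + r₂ := by positivity
    have ha : 0 ≤ r₂ / (r₁ + r₂) := by positivity
    have hb : 0 ≤ r₁ / (r₁ + r₂) := by positivity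
    have := hu.concaveOn.2 hΩ₁ hΩ₂ ha hb (by field_simp; ring)
    rw [hu.eq_zero_of_mem_frontier _ hb₁, hu.eq_zero_of_mem_frontier _ hb₂] at this
    have heq : (r₂ / (r₁ + r₂)) • (z + r₁ • h) + (r₁ / (r₁ + r₂)) • (z + r₂ • -h) = z := by
      match_scalars <;> field_simp <;> ring
    rw [heq] at this
    simpa using this
  exact huz (le_antisymm hle hge)

end IsAdmissible

/-! ### Parallelograms and the reflection estimate -/

section Parallelogram

variable {c v w : Plane}

/-- The affine coordinates with origin `c` and axes along `v` and `w`. -/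
noncomputable def parallelogramChart (c : Plane) (h : LinearIndependent ℝ ![v, w]) :
    Plane ≃ₜ (Fin 2 → ℝ) :=
  (Homeomorph.subRight c).trans
    (basisOfLinearIndependentOfCardEqFinrank h (by simp)).equivFunL.toHomeomorph

theorem add_chart_smul (c : Plane) (h : LinearIndependent ℝ ![v, w]) (z : Plane) :
    c + parallelogramChart c h z 0 • v + parallelogramChart c h z 1 • w = z := by
  set b := basisOfLinearIndependentOfCardEqFinrank h (by simp) with hb
  have h1 := b.sum_equivFun (z - c)
  rw [Fin.sum_univ_two] at h1
  have h2 : c + (b.equivFun (z - c) 0 • b 0 + b.equivFun (z - c) 1 • b 1) = z := by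
    rw [h1]; abel
  have hb0 : b 0 = v := by simp [hb]
  have hb1 : b 1 = w := by simp [hb]
  rw [← add_assoc, hb0, hb1] at h2
  exact h2

theorem chart_add_smul (c : Plane) (h : LinearIndependent ℝ ![v, w]) (s t : ℝ) :
    parallelogramChart c h (c + s • v + t • w) = ![s, t] := by
  have h1 := add_chart_smul c h (c + s • v + t • w)
  obtain ⟨h2, h3⟩ := LinearIndependent.pair_iff.1 h
    (parallelogramChart c h (c + s • v + t • w) 0 - s)
    (parallelogramChart c h (c + s • v + t • w) 1 - t) (by
      have := sub_eq_zero.2 h1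
      rw [← this]
      module)
  funext i
  fin_cases i
  · simpa using sub_eq_zero.1 h2
  · simpa using sub_eq_zero.1 h3

theorem parallelogram_eq_preimage (c : Plane) (h : LinearIndependent ℝ ![v, w]) :
    parallelogram c v w = parallelogramChart c h ⁻¹' Icc 0 1 := by
  ext z
  constructor
  · rintro ⟨s, hs, t, ht, rfl⟩
    rw [mem_preimage, chart_add_smul, mem_Icc, Pi.le_def, Pi.le_def]
    simp [Fin.forall_fin_two, hs.1, hs.2, ht.1, ht.2]
  · intro hz
    exact ⟨_, ⟨hz.1 0, hz.2 0⟩, _, ⟨hz.1 1, hz.2 1⟩, (add_chart_smul c h z).symm⟩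

theorem interior_parallelogram (c : Plane) (h : LinearIndependent ℝ ![v, w]) :
    interior (parallelogram c v w) =
      {z | ∃ s ∈ Ioo (0 : ℝ) 1, ∃ t ∈ Ioo (0 : ℝ) 1, z = c + s • v + t • w} := by
  rw [parallelogram_eq_preimage c h, ← Homeomorph.preimage_interior, ← pi_univ_Icc,
    interior_pi_set finite_univ]
  ext z
  simp only [interior_Icc, mem_preimage, mem_univ_pi, Fin.forall_fin_two]
  constructor
  · rintro ⟨h0, h1⟩
    exact ⟨_, h0, _, h1, (add_chart_smul c h z).symm⟩
  · rintro ⟨s, hs, t, ht, rfl⟩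
    rw [chart_add_smul]
    exact ⟨hs, ht⟩

theorem isConvexDomain_parallelogram (c : Plane) (h : LinearIndependent ℝ ![v, w]) :
    IsConvexDomain (parallelogram c v w) where
  isCompact := by
    rw [parallelogram_eq_preimage c h]
    exact (parallelogramChart c h).isCompact_preimage.2 isCompact_Icc
  convex := by
    rintro _ ⟨s, hs, t, ht, rfl⟩ _ ⟨s', hs', t', ht', rfl⟩ a b ha hb hab
    refine ⟨a • s + b • s', convex_Icc 0 1 hs hs' ha hb hab, a • t + b • t',
      convex_Icc 0 1 ht ht' ha hb hab, ?_⟩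
    have hc : c = (a + b) • c := by rw [hab, one_smul]
    conv_rhs => rw [hc]
    simp only [smul_eq_mul]
    module
  interior_nonempty := by
    rw [interior_parallelogram c h]
    exact ⟨_, 1 / 2, by norm_num, 1 / 2, by norm_num, rfl⟩

theorem parallelogram_swap (c v w : Plane) : parallelogram c v w = parallelogram c w v := by
  ext z
  constructor <;> rintro ⟨s, hs, t, ht, rfl⟩ <;> exact ⟨t, ht, s, hs, by abel⟩

theorem parallelogram_flip (c v w : Plane) :
    parallelogram c v w = parallelogram (c + v) (-v) w := by
  ext z
  constructor
  · rintro ⟨s, hs, t, ht, rfl⟩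
    exact ⟨1 - s, ⟨by linarith [hs.2], by linarith [hs.1]⟩, t, ht, by module⟩
  · rintro ⟨s, hs, t, ht, rfl⟩
    exact ⟨1 - s, ⟨by linarith [hs.2], by linarith [hs.1]⟩, t, ht, by module⟩

/-- The points of the side opposite to `c, c + w` lie on the boundary. -/
theorem mem_frontier_parallelogram (h : LinearIndependent ℝ ![v, w]) {t : ℝ}
    (ht : t ∈ Icc (0 : ℝ) 1) : c + v + t • w ∈ frontier (parallelogram c v w) := by
  refine ⟨subset_closure ⟨1, by simp, t, ht, by simp⟩, fun hmem => ?_⟩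
  rw [interior_parallelogram c h] at hmem
  obtain ⟨s', hs', t', -, heq⟩ := hmem
  have h1 := chart_add_smul c h 1 t
  rw [one_smul, heq, chart_add_smul] at h1
  have := congrFun h1 0
  simp only [Matrix.cons_val_zero] at this
  exact hs'.2.ne this

variable {u : Plane → ℝ} {N : ℝ}

/-- The bound for the descent along `σ v + τ w` when this direction leaves the parallelogram
through the side opposite to `c, c + w`. -/
theorem neg_fderiv_le_of_exit (h : LinearIndependent ℝ ![v, w])
    (hu : IsAdmissible (parallelogram c v w) u) {s t σ τ : ℝ} (hs : s ∈ Ioo (0 : ℝ) 1)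
    (ht : t ∈ Ioo (0 : ℝ) 1) (hσ : 0 < σ) (hτ : 0 < τ) (hexit : (1 - s) * τ ≤ (1 - t) * σ)
    (hN : ∀ᵐ z ∂volume.restrict (parallelogram c v w), |fderiv ℝ u z (σ • v - τ • w)| ≤ N)
    (hd : DifferentiableAt ℝ u (c + s • v + t • w)) :
    -(fderiv ℝ u (c + s • v + t • w) (σ • v + τ • w)) ≤ N := by
  have hΩ := isConvexDomain_parallelogram c h
  set Ω := parallelogram c v w with hΩdef
  set T := (1 - s) / σ with hT
  -- `T` is the time at which the ray from the point with coordinates `(s, t)` reaches the side `s =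
  -- 1`; `hexit` says that it does so no later than the line `t = 1`.
  have hT0 : 0 < T := div_pos (by linarith [hs.2]) hσ
  have hTσ : T * σ = 1 - s := div_mul_cancel₀ _ hσ.ne'
  have hTτ : T * τ ≤ 1 - t := by
    rw [hT, div_mul_eq_mul_div, div_le_iff₀ hσ]
    exact hexit
  set z := c + s • v + t • w with hz
  have hzΩ : z ∈ interior Ω := by
    rw [hΩdef, interior_parallelogram c h]
    exact ⟨s, hs, t, ht, rfl⟩
  set y := z + T • (σ • v + τ • w) with hy
  have hyfr : y ∈ frontier Ω := by
    have : y = c + v + (t + T * τ) • w := by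
      have : y = c + (s + T * σ) • v + (t + T * τ) • w := by rw [hy, hz]; module
      rw [this, hTσ, add_sub_cancel, one_smul]
    rw [this]
    exact mem_frontier_parallelogram h ⟨by have := ht.1; positivity, by linarith⟩
  have hyΩ : y ∈ Ω := hΩ.isCompact.isClosed.frontier_subset hyfr
  have hxfr : c + v + t • w ∈ frontier Ω := mem_frontier_parallelogram h ⟨ht.1.le, ht.2.le⟩
  -- The decisive coincidence: in coordinates both sides equal `((1 + s) / 2, t + T * τ / 2)`.
  have hq : (1 / 2 : ℝ) • z + (1 / 2 : ℝ) • y = c + v + t • w + (-(T / 2)) • (σ • v - τ • w) := by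
    have h1 : (1 / 2 : ℝ) • z + (1 / 2 : ℝ) • y =
        c + (s + T * σ / 2) • v + (t + T * τ / 2) • w := by rw [hy, hz]; module
    have h2 : c + v + t • w + (-(T / 2)) • (σ • v - τ • w) =
        c + (1 - T * σ / 2) • v + (t + T * τ / 2) • w := by module
    rw [h1, h2, hTσ]
    congr 3
    ring
  have hqΩ : c + v + t • w + (-(T / 2)) • (σ • v - τ • w) ∈ interior Ω := by
    rw [← hq]
    exact hΩ.convex.combo_interior_self_mem_interior hzΩ hyΩ (by norm_num) (by norm_num)
      (by norm_num)
  have h1 := hu.concaveOn.le_add_fderiv (interior_subset hzΩ) hyΩ hd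
  have h2 := hu.le_add_mul_abs hΩ hN (hΩ.isCompact.isClosed.frontier_subset hxfr) hqΩ
  have h3 := hu.concaveOn.2 (interior_subset hzΩ) hyΩ (by norm_num : (0 : ℝ) ≤ 1 / 2)
    (by norm_num : (0 : ℝ) ≤ 1 / 2) (by norm_num)
  rw [hq, hu.eq_zero_of_mem_frontier y hyfr] at h3
  rw [hu.eq_zero_of_mem_frontier _ hxfr, abs_neg, abs_of_pos (by positivity)] at h2
  rw [← hy, hu.eq_zero_of_mem_frontier y hyfr, map_smul, smul_eq_mul] at h1
  simp only [smul_eq_mul] at h3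
  refine le_of_mul_le_mul_left ?_ hT0
  linarith

/-- If the ray leaves through the other far side, exchange `v` and `w`; the reflected direction only
changes sign. -/
theorem neg_fderiv_le_of_pos (h : LinearIndependent ℝ ![v, w])
    (hu : IsAdmissible (parallelogram c v w) u) {s t σ τ : ℝ} (hs : s ∈ Ioo (0 : ℝ) 1)
    (ht : t ∈ Ioo (0 : ℝ) 1) (hσ : 0 < σ) (hτ : 0 < τ)
    (hN : ∀ᵐ z ∂volume.restrict (parallelogram c v w), |fderiv ℝ u z (σ • v - τ • w)| ≤ N)
    (hd : DifferentiableAt ℝ u (c + s • v + t • w)) :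
    -(fderiv ℝ u (c + s • v + t • w) (σ • v + τ • w)) ≤ N := by
  rcases le_total ((1 - s) * τ) ((1 - t) * σ) with hexit | hexit
  · exact neg_fderiv_le_of_exit h hu hs ht hσ hτ hexit hN hd
  · have hz : c + s • v + t • w = c + t • w + s • v := by abel
    rw [parallelogram_swap] at hu hN
    rw [hz] at hd ⊢
    rw [add_comm (σ • v)]
    refine neg_fderiv_le_of_exit (LinearIndependent.pair_symm_iff.1 h) hu ht hs hτ hσ hexit ?_ hd
    filter_upwards [hN] with x hx
    rwa [← neg_sub (σ • v), map_neg, abs_neg]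

/-- A negative `σ` is made positive by taking `c + v` as origin and `-v` as side. -/
theorem neg_fderiv_le_of_pos_right (h : LinearIndependent ℝ ![v, w])
    (hu : IsAdmissible (parallelogram c v w) u) {s t σ τ : ℝ} (hs : s ∈ Ioo (0 : ℝ) 1)
    (ht : t ∈ Ioo (0 : ℝ) 1) (hσ : σ ≠ 0) (hτ : 0 < τ)
    (hN : ∀ᵐ z ∂volume.restrict (parallelogram c v w), |fderiv ℝ u z (σ • v - τ • w)| ≤ N)
    (hd : DifferentiableAt ℝ u (c + s • v + t • w)) :
    -(fderiv ℝ u (c + s • v + t • w) (σ • v + τ • w)) ≤ N := by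
  rcases hσ.lt_or_gt with hσ | hσ
  · have hz : c + s • v + t • w = c + v + (1 - s) • (-v) + t • w := by module
    have hv : σ • v = (-σ) • (-v) := by simp
    rw [parallelogram_flip] at hu hN
    rw [hz] at hd ⊢
    rw [hv]
    rw [hv] at hN
    exact neg_fderiv_le_of_pos (LinearIndependent.pair_neg_left_iff.2 h) hu
      ⟨by linarith [hs.2], by linarith [hs.1]⟩ ht (neg_pos.2 hσ) hτ hN hd
  · exact neg_fderiv_le_of_pos h hu hs ht hσ hτ hN hd

theorem neg_fderiv_le (h : LinearIndependent ℝ ![v, w])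
    (hu : IsAdmissible (parallelogram c v w) u) {s t σ τ : ℝ} (hs : s ∈ Ioo (0 : ℝ) 1)
    (ht : t ∈ Ioo (0 : ℝ) 1) (hσ : σ ≠ 0) (hτ : τ ≠ 0)
    (hN : ∀ᵐ z ∂volume.restrict (parallelogram c v w), |fderiv ℝ u z (σ • v - τ • w)| ≤ N)
    (hd : DifferentiableAt ℝ u (c + s • v + t • w)) :
    -(fderiv ℝ u (c + s • v + t • w) (σ • v + τ • w)) ≤ N := by
  rcases hτ.lt_or_gt with hτ | hτ
  · have hz : c + s • v + t • w = c + w + s • v + (1 - t) • (-w) := by module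
    have hw : τ • w = (-τ) • (-w) := by simp
    have hpar : parallelogram c v w = parallelogram (c + w) v (-w) := by
      rw [parallelogram_swap, parallelogram_flip, parallelogram_swap]
    rw [hpar] at hu hN
    rw [hz] at hd ⊢
    rw [hw]
    rw [hw] at hN
    exact neg_fderiv_le_of_pos_right (LinearIndependent.pair_neg_right_iff.2 h) hu hs
      ⟨by linarith [ht.2], by linarith [ht.1]⟩ hσ (neg_pos.2 hτ) hN hd
  · exact neg_fderiv_le_of_pos_right h hu hs ht hσ hτ hN hd

theorem dirNorm_parallelogram_le (h : LinearIndependent ℝ ![v, w])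
    (hu : IsAdmissible (parallelogram c v w) u) {σ τ : ℝ} (hσ : σ ≠ 0) (hτ : τ ≠ 0) :
    dirNorm ∞ (parallelogram c v w) u (σ • v + τ • w) ≤
      dirNorm ∞ (parallelogram c v w) u (σ • v - τ • w) := by
  have hΩ := isConvexDomain_parallelogram c h
  have hN := hu.ae_abs_fderiv_le hΩ (σ • v - τ • w)
  rw [← ENNReal.ofReal_toReal (hu.dirNorm_top_lt_top hΩ (σ • v - τ • w)).ne]
  refine IsAdmissible.dirNorm_top_le hΩ ENNReal.toReal_nonneg fun z hz hd => ?_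
  rw [interior_parallelogram c h] at hz
  obtain ⟨s, hs, t, ht, rfl⟩ := hz
  have h1 := neg_fderiv_le h hu hs ht hσ hτ hN hd
  -- The opposite direction supplies the upper bound for the derivative.
  have h2 := neg_fderiv_le h hu hs ht (neg_ne_zero.2 hσ) (neg_ne_zero.2 hτ) (by
    filter_upwards [hN] with x hx
    have : (-σ) • v - (-τ) • w = -(σ • v - τ • w) := by module
    rwa [this, map_neg, abs_neg]) hd
  have h3 : (-σ) • v + (-τ) • w = -(σ • v + τ • w) := by module
  rw [h3, map_neg, neg_neg] at h2
  exact abs_le.2 ⟨by linarith, h2⟩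

/-- On a parallelogram with sides parallel to `h₁ + h₂` and `h₁ - h₂`, the derivatives along `h₁`
and `h₂` have equal `L_∞` norms. -/
theorem dirNorm_parallelogram_eq (h : LinearIndependent ℝ ![v, w])
    (hu : IsAdmissible (parallelogram c v w) u) {h₁ h₂ : Plane}
    (hv : ∃ a : ℝ, v = a • (h₁ + h₂)) (hw : ∃ b : ℝ, w = b • (h₁ - h₂)) :
    dirNorm ∞ (parallelogram c v w) u h₁ = dirNorm ∞ (parallelogram c v w) u h₂ := by
  obtain ⟨a, ha⟩ := hv
  obtain ⟨b, hb⟩ := hw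
  have ha0 : a ≠ 0 := fun h0 => h.ne_zero 0 (by simp [ha, h0])
  have hb0 : b ≠ 0 := fun h0 => h.ne_zero 1 (by simp [hb, h0])
  have hσ : (2 * a)⁻¹ ≠ 0 := by positivity
  have hτ : (2 * b)⁻¹ ≠ 0 := by positivity
  have e₁ : h₁ = (2 * a)⁻¹ • v + (2 * b)⁻¹ • w := by
    rw [ha, hb]
    match_scalars <;> field_simp <;> ring
  have e₂ : h₂ = (2 * a)⁻¹ • v - (2 * b)⁻¹ • w := by
    rw [ha, hb]
    match_scalars <;> field_simp <;> ring
  have k₁ := dirNorm_parallelogram_le h hu hσ hτ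
  -- Changing the sign of `τ` exchanges `h₁` and `h₂`.
  have k₂ := dirNorm_parallelogram_le h hu hσ (neg_ne_zero.2 hτ)
  rw [neg_smul, sub_neg_eq_add, ← sub_eq_add_neg] at k₂
  rw [← e₁, ← e₂] at k₁ k₂
  exact le_antisymm k₁ k₂

end Parallelogram

/-! ### Extremal ratios and their quotient -/

theorem dirNorm_smul (p : ℝ≥0∞) (Ω : Set Plane) (u : Plane → ℝ) (m : ℝ) (h : Plane) :
    dirNorm p Ω u (m • h) = ‖m‖ₑ * dirNorm p Ω u h := by
  simp only [dirNorm, map_smul]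
  exact eLpNorm_const_smul m _ p _

/-- The quotient of the extremal ratios is at least `1` on every convex domain. -/
theorem one_le_supRatio_div_infRatio {Ω : Set Plane} (hΩ : IsConvexDomain Ω) {h₁ h₂ : Plane}
    (h₁0 : h₁ ≠ 0) (h₂0 : h₂ ≠ 0) : 1 ≤ supRatio ∞ Ω h₁ h₂ / infRatio ∞ Ω h₁ h₂ := by
  obtain ⟨u, hu⟩ := hΩ.admissibleNonzero_nonempty
  set r := dirNorm ∞ Ω u h₁ / dirNorm ∞ Ω u h₂ with hr
  have hr0 : r ≠ 0 := ENNReal.div_ne_zero.2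
    ⟨IsAdmissible.dirNorm_top_ne_zero hΩ hu h₁0, (hu.1.dirNorm_top_lt_top hΩ h₂).ne⟩
  have hr1 : r ≠ ∞ := ENNReal.div_ne_top (hu.1.dirNorm_top_lt_top hΩ h₁).ne
    (IsAdmissible.dirNorm_top_ne_zero hΩ hu h₂0)
  -- As the supremum is at least `r > 0` and the infimum at most `r < ∞`, the forms 0/0 and ∞/∞,
  -- which `ℝ≥0∞` evaluates to 0, do not arise.
  calc 1 = r / r := (ENNReal.div_self hr0 hr1).symm
    _ ≤ supRatio ∞ Ω h₁ h₂ / infRatio ∞ Ω h₁ h₂ :=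
      ENNReal.div_le_div (le_iSup₂ (f := fun u (_ : u ∈ admissibleNonzero Ω) =>
        dirNorm ∞ Ω u h₁ / dirNorm ∞ Ω u h₂) u hu) (iInf₂_le u hu)

/-- If the two norms are proportional on all admissible functions, the quotient of the extremal
ratios is `1`. -/
theorem supRatio_div_infRatio_eq_one {Ω : Set Plane} (hΩ : IsConvexDomain Ω) {h₁ h₂ : Plane}
    (h₁0 : h₁ ≠ 0) (h₂0 : h₂ ≠ 0) {κ : ℝ≥0∞}
    (hκ : ∀ u ∈ admissibleNonzero Ω, dirNorm ∞ Ω u h₁ = κ * dirNorm ∞ Ω u h₂) :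
    supRatio ∞ Ω h₁ h₂ / infRatio ∞ Ω h₁ h₂ = 1 := by
  have hratio : ∀ u ∈ admissibleNonzero Ω, dirNorm ∞ Ω u h₁ / dirNorm ∞ Ω u h₂ = κ :=
    fun u hu => by
      rw [hκ u hu]
      exact ENNReal.mul_div_cancel_right (IsAdmissible.dirNorm_top_ne_zero hΩ hu h₂0)
        (hu.1.dirNorm_top_lt_top hΩ h₂).ne
  obtain ⟨u, hu⟩ := hΩ.admissibleNonzero_nonempty
  have hκ0 : κ ≠ 0 := by
    rw [← hratio u hu]
    exact ENNReal.div_ne_zero.2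
      ⟨IsAdmissible.dirNorm_top_ne_zero hΩ hu h₁0, (hu.1.dirNorm_top_lt_top hΩ h₂).ne⟩
  have hκ1 : κ ≠ ∞ := by
    rw [← hratio u hu]
    exact ENNReal.div_ne_top (hu.1.dirNorm_top_lt_top hΩ h₁).ne
      (IsAdmissible.dirNorm_top_ne_zero hΩ hu h₂0)
  refine le_antisymm ?_ (one_le_supRatio_div_infRatio hΩ h₁0 h₂0)
  calc supRatio ∞ Ω h₁ h₂ / infRatio ∞ Ω h₁ h₂ ≤ κ / κ :=
      ENNReal.div_le_div (iSup₂_le fun u hu => (hratio u hu).le)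
        (le_iInf₂ fun u hu => (hratio u hu).ge)
    _ = 1 := ENNReal.div_self hκ0 hκ1

theorem dirX_ne_zero : dirX ≠ 0 := by
  simp [dirX]

theorem dirY_ne_zero : dirY ≠ 0 := by
  simp [dirY]

theorem isConvexDomain_closedBall : IsConvexDomain (closedBall (0 : Plane) 1) where
  isCompact := isCompact_closedBall 0 1
  convex := convex_closedBall 0 1
  interior_nonempty := ⟨0, ball_subset_interior_closedBall (mem_ball_self one_pos)⟩

theorem supRatio_div_infRatio_parallelogram {c v w h₁ h₂ : Plane}
    (h : LinearIndependent ℝ ![v, w]) (h₁0 : h₁ ≠ 0) (h₂0 : h₂ ≠ 0)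
    (hv : ∃ a : ℝ, v = a • (h₁ + h₂)) (hw : ∃ b : ℝ, w = b • (h₁ - h₂)) :
    supRatio ∞ (parallelogram c v w) h₁ h₂ / infRatio ∞ (parallelogram c v w) h₁ h₂ = 1 :=
  supRatio_div_infRatio_eq_one (isConvexDomain_parallelogram c h) h₁0 h₂0 (κ := 1) fun u hu => by
    rw [one_mul]
    exact dirNorm_parallelogram_eq h hu.1 hv hw

/-- Some convex domain has quotient `1`. -/
theorem exists_supRatio_div_infRatio_eq_one {h₁ h₂ : Plane} (h₁0 : h₁ ≠ 0) (h₂0 : h₂ ≠ 0) :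
    ∃ Ω, IsConvexDomain Ω ∧ supRatio ∞ Ω h₁ h₂ / infRatio ∞ Ω h₁ h₂ = 1 := by
  by_cases hli : LinearIndependent ℝ ![h₁ + h₂, h₁ - h₂]
  · exact ⟨parallelogram 0 (h₁ + h₂) (h₁ - h₂), isConvexDomain_parallelogram 0 hli,
      supRatio_div_infRatio_parallelogram hli h₁0 h₂0 ⟨1, by simp⟩ ⟨1, by simp⟩⟩
  · have hcol : ∃ m : ℝ, h₁ = m • h₂ := by
      by_contra! hcon
      refine hli (LinearIndependent.pair_iff.2 fun s t hst => ?_)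
      have h2 : LinearIndependent ℝ ![h₂, h₁] :=
        (LinearIndependent.pair_iff' h₂0).2 fun a => (hcon a).symm
      obtain ⟨k₁, k₂⟩ := LinearIndependent.pair_iff.1 h2 (s - t) (s + t) (by
        rw [← hst]; module)
      exact ⟨by linarith, by linarith⟩
    obtain ⟨m, rfl⟩ := hcol
    exact ⟨_, isConvexDomain_closedBall, supRatio_div_infRatio_eq_one isConvexDomain_closedBall
      h₁0 h₂0 fun u _ => dirNorm_smul ∞ _ u m h₂⟩

theorem iInf_supRatio_div_infRatio {h₁ h₂ : Plane} (h₁0 : h₁ ≠ 0) (h₂0 : h₂ ≠ 0) :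
    (⨅ (Ω : Set Plane) (_ : IsConvexDomain Ω),
      supRatio ∞ Ω h₁ h₂ / infRatio ∞ Ω h₁ h₂) = 1 := by
  obtain ⟨Ω, hΩ, h⟩ := exists_supRatio_div_infRatio_eq_one h₁0 h₂0
  exact le_antisymm (h ▸ iInf₂_le Ω hΩ)
    (le_iInf₂ fun Ω' hΩ' => one_le_supRatio_div_infRatio hΩ' h₁0 h₂0)

/-- Opposite slopes make the sides parallel to `dirX + m • dirY` and `dirX - m • dirY`. -/
theorem bigK_div_smallK_parallelogram {c v w : Plane} (h : LinearIndependent ℝ ![v, w])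
    (hv : v 0 ≠ 0) (hw : w 0 ≠ 0) (hslope : |v 1 / v 0| = |w 1 / w 0|) :
    bigK ∞ (parallelogram c v w) / smallK ∞ (parallelogram c v w) = 1 := by
  set m := v 1 / v 0 with hm
  have hv1 : v 1 = v 0 * m := by rw [hm]; field_simp
  -- Equal signed slopes would make `v` and `w` parallel, so the slopes are `m` and `-m`.
  have hnot : m ≠ w 1 / w 0 := fun heq => by
    have hw1 : w 1 = w 0 * m := by rw [heq]; field_simp
    have := LinearIndependent.pair_iff.1 h (w 0) (-(v 0)) (by
      ext i
      fin_cases i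
      · simp; ring
      · simp [hv1, hw1]; ring)
    exact hw this.1
  have hw1 : w 1 = -(w 0 * m) := by
    have : w 1 / w 0 = -m := by
      rcases abs_eq_abs.1 hslope with h1 | h1
      · exact absurd h1 hnot
      · linarith
    rw [div_eq_iff hw] at this
    linarith
  have hm0 : m ≠ 0 := fun h0 => hnot (by
    rw [h0] at hw1 ⊢
    simp [hw1])
  have hvm : v = v 0 • (dirX + m • dirY) := by
    ext i
    fin_cases i
    · simp [dirX, dirY]
    · simp [dirX, dirY, hv1]
  have hwm : w = w 0 • (dirX - m • dirY) := by
    ext i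
    fin_cases i
    · simp [dirX, dirY]
    · simp [dirX, dirY, hw1]
  refine supRatio_div_infRatio_eq_one (isConvexDomain_parallelogram c h) dirX_ne_zero dirY_ne_zero
    (κ := ‖m‖ₑ) fun u hu => ?_
  rw [← dirNorm_smul]
  exact dirNorm_parallelogram_eq h hu.1 ⟨_, hvm⟩ ⟨_, hwm⟩

theorem mainTheorem11 :
    ((⨅ (Ω : Set Plane) (_ : IsConvexDomain Ω), bigK ∞ Ω / smallK ∞ Ω) = 1 ∧
      ∀ c v w : Plane, LinearIndependent ℝ ![v, w] →
        v 0 ≠ 0 → w 0 ≠ 0 → |v 1 / v 0| = |w 1 / w 0| →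
          IsConvexDomain (parallelogram c v w) ∧
            bigK ∞ (parallelogram c v w) / smallK ∞ (parallelogram c v w) = 1) ∧
    ∀ h₁ h₂ : Plane, h₁ ≠ 0 → h₂ ≠ 0 →
      (⨅ (Ω : Set Plane) (_ : IsConvexDomain Ω),
        supRatio ∞ Ω h₁ h₂ / infRatio ∞ Ω h₁ h₂) = 1 ∧
      ∀ c v w : Plane, LinearIndependent ℝ ![v, w] →
        (∃ a : ℝ, v = a • (h₁ + h₂)) → (∃ b : ℝ, w = b • (h₁ - h₂)) →
          IsConvexDomain (parallelogram c v w) ∧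
            supRatio ∞ (parallelogram c v w) h₁ h₂ / infRatio ∞ (parallelogram c v w) h₁ h₂ = 1 := by
  refine ⟨⟨iInf_supRatio_div_infRatio dirX_ne_zero dirY_ne_zero, fun c v w h hv hw hslope =>
    ⟨isConvexDomain_parallelogram c h, bigK_div_smallK_parallelogram h hv hw hslope⟩⟩,
    fun h₁ h₂ h₁0 h₂0 => ⟨iInf_supRatio_div_infRatio h₁0 h₂0, fun c v w h hv hw =>
      ⟨isConvexDomain_parallelogram c h,
        supRatio_div_infRatio_parallelogram h h₁0 h₂0 hv hw⟩⟩⟩
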